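/- Let $G\sim G(n,\tfrac12)$ be a random graph on $V=[n]$, each edge being present independently with probability $\tfrac12$. Fix an integer $d\ge 1$. For $I\subseteq V$ let $\deg_G(I)$ be the number of $2d$-cliques of $G$ (cliques with $2d$ vertices) that contain $I$, and let $C_{2d}(G)=\deg_G(\emptyset)$ be the number of all $2d$-cliques. For real $\omega$, the degree-$2d$ MPW (Meka–Potechin–Wigderson) operator for clique size $\omega$ is the linear functional $\tilde{\mathbb E}=\tilde{\mathbb E}_{G,\omega}$ on real polynomials of degree at most $2d$ in $x_1,\dots,x_n$ that sends every monomial whose set of variables is $I$ (so that $x_i^2$ is identified with $x_i$) to $$\frac{\deg_G(I)}{C_{2d}(G)}\cdot\frac{\binom{\omega}{|I|}}{\binom{2d}{|I|}},\qquad \binom{\omega}{k}=\frac{\omega(\omega-1)\cdots(\omega-k+1)}{k!}$$ (and $\tilde{\mathbb E}=0$ if $G$ has no $2d$-clique). It is called PSD if $\tilde{\mathbb E}[p^2]\ge 0$ for every polynomial $p$ of degree at most $d$. Its moment matrix $\mathcal M_{G,\omega}$, indexed by the $d$-element subsets of $V$, has the entries $\mathcal M_{G,\omega}(I,J)=\deg_G(I\cup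 J)\binom{\omega}{|I\cup J|}/\binom{2d}{|I\cup J|}$. For $s,i\in V$ let $r_s(i)=1$ if $s\sim i$, $r_s(i)=-1$ if $i\ne s$ and $s\not\sim i$, and $r_s(s)=0$. Theorem. For every $d\ge1$ there is a constant $C>0$, depending only on $d$, such that for every sequence of real numbers $\omega=\omega(n)$ with $\omega(n)/n^{1/(d+1)}\to\infty$ the following hold. 1. With probability tending to $1$ as $n\to\infty$, the operator $\tilde{\mathbb E}_{G,\omega(n)}$ is not PSD. 2. With probability tending to $1$ as $n\to\infty$, the matrix $\mathcal M_{G,\omega(n)}$ is not positive semidefinite. (So the range $\omega\le\tilde O(n^{1/(d+1)})$, in which $\mathcal M_{G,\omega}$ is known to be positive semidefinite with high probability, is optimal up to polylogarithmic factors.) 3. For each vertex $s$, with probability tending to $1$ as $n\to\infty$ (at a rate that is uniform in $s\in V$), $$\tilde{\mathbb E}_{G,\omega(n)}\Big[\Big(C\,\omega(n)^d\,x_s-\sum_{I\subseteq V,\ |I|=d}\ \prod_{i\in I}r_s(i)\,x_i\Big)^2\Big]<0 .$$ -/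

import Mathlib

open Filter Topology MeasureTheory

noncomputable section

namespace PlantedClique

/-- The number of cliques of size `2 * d` of `G` that contain the vertex set `I`. -/
def cliqueDeg {n : ℕ} (G : SimpleGraph (Fin n)) (d : ℕ) (I : Finset (Fin n)) : ℕ :=
  {S : Finset (Fin n) | I ⊆ S ∧ G.IsNClique (2 * d) S}.ncard

/-- The number `C_{2d}` of cliques of size `2 * d` of `G`. -/
def cliqueCount {n : ℕ} (G : SimpleGraph (Fin n)) (d : ℕ) : ℕ :=
  {S : Finset (Fin n) | G.IsNClique (2 * d) S}.ncard

/-- The MPW moment of the multilinear monomial `x_I`, for `|I| ≤ 2 * d`.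
`Ring.choose ω k = ω (ω - 1) ⋯ (ω - k + 1) / k!` is the generalized binomial coefficient of the
real number `ω`. -/
def mpwMoment {n : ℕ} (G : SimpleGraph (Fin n)) (d : ℕ) (ω : ℝ) (I : Finset (Fin n)) : ℝ :=
  (cliqueDeg G d I : ℝ) / (cliqueCount G d : ℝ) *
    (Ring.choose ω I.card / ((2 * d).choose I.card : ℝ))

/-- The MPW operator of degree `2 * d` for clique size `ω`. It is the linear functional that sends a
monomial `∏ i, x_i ^ (m i)` to the moment of its multilinear reduction (by `x_i ^ 2 = x_i`), the
monomial of its support. Only its values on polynomials of degree at most `2 * d` matter. -/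
def mpw {n : ℕ} (G : SimpleGraph (Fin n)) (d : ℕ) (ω : ℝ) : MvPolynomial (Fin n) ℝ →ₗ[ℝ] ℝ :=
  (MvPolynomial.basisMonomials (Fin n) ℝ).constr ℝ fun m => mpwMoment G d ω m.support

/-- Positivity of a linear functional in degree `2 * d`: squares of polynomials of degree at most
`d` have nonnegative value. -/
def IsPSD {n : ℕ} (L : MvPolynomial (Fin n) ℝ →ₗ[ℝ] ℝ) (d : ℕ) : Prop :=
  ∀ p : MvPolynomial (Fin n) ℝ, p.totalDegree ≤ d → 0 ≤ L (p ^ 2)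

/-- The (unnormalized) MPW moment matrix, indexed by the `d`-element vertex sets. -/
def mpwMatrix {n : ℕ} (G : SimpleGraph (Fin n)) (d : ℕ) (ω : ℝ) :
    Matrix {I : Finset (Fin n) // I.card = d} {I : Finset (Fin n) // I.card = d} ℝ :=
  Matrix.of fun I J =>
    (cliqueDeg G d (I.1 ∪ J.1) : ℝ) *
      (Ring.choose ω (I.1 ∪ J.1).card / ((2 * d).choose (I.1 ∪ J.1).card : ℝ))

open Classical in
/-- The signed neighbourhood vector of the vertex `s`. -/
def nbr {n : ℕ} (G : SimpleGraph (Fin n)) (s i : Fin n) : ℝ :=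
  if i = s then 0 else if G.Adj s i then 1 else -1

/-- The polynomial `C ω^d x_s - ∑_{|I| = d} ∏_{i ∈ I} r_s(i) x_i`. -/
def kelnerPoly {n : ℕ} (G : SimpleGraph (Fin n)) (d : ℕ) (ω C : ℝ) (s : Fin n) :
    MvPolynomial (Fin n) ℝ :=
  MvPolynomial.C (C * ω ^ d) * MvPolynomial.X s -
    ∑ I ∈ (Finset.univ : Finset (Fin n)).powersetCard d,
      ∏ i ∈ I, (MvPolynomial.C (nbr G s i) * MvPolynomial.X i)

/-- The law `G(n, 1/2)` of the random graph in which every edge is present independently with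
probability `1/2`. -/
def randomGraph (n : ℕ) : Measure (SimpleGraph (Fin n)) :=
  SimpleGraph.binomialRandom (Fin n) ⟨1 / 2, by norm_num, by norm_num⟩

/-- An event about a graph on `n` vertices holds with high probability if its probability under
`G(n, 1/2)` tends to `1`. -/
def WithHighProbability (A : ∀ n : ℕ, SimpleGraph (Fin n) → Prop) : Prop :=
  Tendsto (fun n => (randomGraph n).real {G | A n G}) atTop (𝓝 1)

end PlantedClique

end

/-!
The polynomial `p = C ω ^ d x_s - ∑ ∏ r_s(i) x_i` has negative value because of the cliques through
`s`. Multiplied by the number of `2d`-cliques, the value of `p ^ 2` is a sum of contributions of the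
single cliques `S` (`quadForm_eq_sum_localForm`). If `S` contains `s`, all signs `r_s(i)` with
`i ∈ S`, `i ≠ s` equal `1`. The square of the first term contributes at most a constant times
`C ^ 2 ω ^ (2d+1)`, the mixed term at most a negative constant times `C ω ^ (2d+1)`, and the square
of the sum only `O(ω ^ (2d-1))`, because a union of two index sets misses `s`
(`localForm_testVec_of_mem`). For small `C` the total over these cliques is negative of order
`n ^ (2d-1) ω ^ (2d+1)`, since `s` lies in a positive fraction of the possible cliques
(`exists_cliqueDeg_lower`, by Chebyshev's inequality).

If `S` avoids `s`, only the square of the sum contributes. Its diagonal terms add up to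
`O(n ^ (2d) ω ^ d)`, which is smaller exactly when `ω ^ (d+1) ≫ n`. In the other terms the signs are
independent of the cliques. The contributions of two cliques that share at most one vertex are
uncorrelated (`sum_offDiagForm_mul_eq_zero`), so that the standard deviation is
`O(n ^ (2d-1) ω ^ (2d))` (`offDiagSum_tail`), smaller by the factor `ω`.

For the moment matrix the same argument applies with `x_s` replaced by a multiple of `∑ x_A`, where
`A` runs over the `d`-sets that contain `s`. Both cases are treated together: `A` runs over the
`a`-sets that contain `s`, with `a = 1` or `a = d` (`testVec`).
-/

namespace PlantedClique

open Finset
open scoped Classical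

variable {n : ℕ}

/-! ### The uniform law on graphs -/

instance instMeasurableSingletonClassGraph : MeasurableSingletonClass (SimpleGraph (Fin n)) where
  measurableSet_singleton G := by
    have h := SimpleGraph.measurable_edgeSet (V := Fin n) (measurableSet_singleton G.edgeSet)
    convert! h
    ext H
    simp

lemma randomGraph_real_eq (A : SimpleGraph (Fin n) → Prop) :
    (randomGraph n).real {G | A G} =
      (#{G : SimpleGraph (Fin n) | A G} : ℝ) / Fintype.card (SimpleGraph (Fin n)) := by
  have : IsProbabilityMeasure (randomGraph n) := by unfold randomGraph; infer_instance
  have hc : ∃ c : ℝ, ∀ G : SimpleGraph (Fin n), (randomGraph n).real {G} = c := by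
    refine ⟨(1 / 2 : ℝ) ^ ((Nat.card (Fin n)).choose 2), fun G => ?_⟩
    have hle : G.edgeSet.ncard ≤ (Nat.card (Fin n)).choose 2 := by
      rw [← SimpleGraph.coe_edgeFinset, Set.ncard_coe_finset, Nat.card_eq_fintype_card]
      exact SimpleGraph.card_edgeFinset_le_card_choose_two
    have hhalf : (1 : ℝ) - 1 / 2 = 1 / 2 := by norm_num
    rw [randomGraph, measureReal_def, SimpleGraph.binomialRandom_singleton]
    simp only [ENNReal.toReal_mul, ENNReal.toReal_pow, ENNReal.coe_toReal,
      unitInterval.coe_toNNReal, unitInterval.coe_symm_eq]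
    rw [hhalf, ← pow_add, Nat.add_sub_cancel' hle]
  obtain ⟨c, hc⟩ := hc
  have key : ∀ s : Finset (SimpleGraph (Fin n)), (randomGraph n).real (s : Set _) = #s * c := by
    intro s
    rw [← sum_measureReal_singleton, Finset.sum_congr rfl fun G _ => hc G, sum_const, nsmul_eq_mul]
  have h1 := key univ
  rw [coe_univ, probReal_univ, card_univ] at h1
  have h2 := key {G | A G}
  rw [coe_filter] at h2
  simp only [mem_univ, true_and] at h2
  rw [h2]
  have h0 : (Fintype.card (SimpleGraph (Fin n)) : ℝ) ≠ 0 := by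
    intro h; rw [h] at h1; simp at h1
  rw [eq_div_iff h0, mul_assoc, mul_comm c, ← h1, mul_one]

/-- The graph obtained from `G` by switching the status of the pair `e`. -/
def toggle (e : Sym2 (Fin n)) (G : SimpleGraph (Fin n)) : SimpleGraph (Fin n) :=
  symmDiff G (SimpleGraph.fromEdgeSet {e})

lemma mem_edgeSet_toggle {e f : Sym2 (Fin n)} (he : ¬ e.IsDiag) (G : SimpleGraph (Fin n)) :
    f ∈ (toggle e G).edgeSet ↔ (f ∈ G.edgeSet ↔ f ≠ e) := by
  rw [toggle, symmDiff_def, SimpleGraph.edgeSet_sup, SimpleGraph.edgeSet_sdiff,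
    SimpleGraph.edgeSet_sdiff, SimpleGraph.edgeSet_fromEdgeSet]
  simp
  grind

lemma sum_toggle (e : Sym2 (Fin n)) (φ : SimpleGraph (Fin n) → ℝ) :
    ∑ G, φ (toggle e G) = ∑ G, φ G := by
  have h : Function.Involutive (toggle e) := fun G => symmDiff_symmDiff_cancel_right _ _
  exact Equiv.sum_comp h.toPerm φ

lemma sum_eq_zero_of_toggle (e : Sym2 (Fin n)) (φ : SimpleGraph (Fin n) → ℝ)
    (h : ∀ G, φ (toggle e G) = -φ G) : ∑ G, φ G = 0 := by
  have h1 := sum_toggle e φ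
  rw [sum_congr rfl fun G _ => h G, sum_neg_distrib] at h1
  linarith

/-- Under the uniform law, `#F` given edges are all present with probability `2 ^ (-#F)`. -/
lemma sum_edges_present (F : Finset (Sym2 (Fin n))) (hF : ∀ e ∈ F, ¬ e.IsDiag) :
    ∑ G : SimpleGraph (Fin n), (if ∀ e ∈ F, e ∈ G.edgeSet then (1 : ℝ) else 0) =
      Fintype.card (SimpleGraph (Fin n)) * (1 / 2) ^ #F := by
  induction F using Finset.induction_on with
  | empty => simp
  | insert e F he ih =>
    have hd := hF e (mem_insert_self _ _)
    have ih := ih fun f hf => hF f (mem_insert_of_mem hf)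
    have h1 := sum_toggle e fun G =>
      if ∀ f ∈ insert e F, f ∈ G.edgeSet then (1 : ℝ) else 0
    -- exactly one of `G` and `toggle e G` contains `e`, and they agree on `F`
    have h2 : ∀ G : SimpleGraph (Fin n),
        (if ∀ f ∈ insert e F, f ∈ G.edgeSet then (1 : ℝ) else 0) +
        (if ∀ f ∈ insert e F, f ∈ (toggle e G).edgeSet then (1 : ℝ) else 0) =
        if ∀ f ∈ F, f ∈ G.edgeSet then (1 : ℝ) else 0 := by
      intro G
      have h3 : (∀ f ∈ F, f ∈ (toggle e G).edgeSet) ↔ ∀ f ∈ F, f ∈ G.edgeSet := by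
        refine forall₂_congr fun f hf => ?_
        rw [mem_edgeSet_toggle hd]
        have : f ≠ e := fun h => he (h ▸ hf)
        simp [this]
      have h4 : e ∈ (toggle e G).edgeSet ↔ e ∉ G.edgeSet := by
        rw [mem_edgeSet_toggle hd]; simp
      simp only [forall_mem_insert, h3, h4]
      by_cases ha : e ∈ G.edgeSet <;> simp [ha]
    have h5 := Finset.sum_congr rfl fun G (_ : G ∈ univ) => h2 G
    rw [sum_add_distrib, h1, ih] at h5
    rw [card_insert_of_notMem he, pow_succ]
    linarith

/-! ### Counting vertex sets -/

lemma card_supersets_le (k : ℕ) (U : Finset (Fin n)) :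
    #{S ∈ powersetCard k (univ : Finset (Fin n)) | U ⊆ S} ≤ n ^ (k - #U) := by
  calc #{S ∈ powersetCard k (univ : Finset (Fin n)) | U ⊆ S}
      ≤ #(powersetCard (k - #U) (univ : Finset (Fin n))) := by
        refine card_le_card_of_injOn (fun S => S \ U) ?_ ?_
        · intro S hS
          simp only [coe_filter, Set.mem_ofPred_eq, mem_powersetCard_univ, mem_coe] at hS ⊢
          rw [card_sdiff_of_subset hS.2, hS.1]
        · intro S hS T hT h
          simp only [coe_filter, Set.mem_ofPred_eq] at hS hT
          rw [← sdiff_union_of_subset hS.2, ← sdiff_union_of_subset hT.2]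
          exact congrArg (· ∪ U) h
    _ ≤ n ^ (k - #U) := by
        rw [card_powersetCard, card_univ, Fintype.card_fin]
        exact Nat.choose_le_pow _ _

/-- Only the first set of a pair uses that it contains `R`; the second is bounded through a common
pair of vertices. -/
lemma card_pairs_le (k : ℕ) (R : Finset (Fin n)) (𝒮 : Finset (Finset (Fin n)))
    (h𝒮 : 𝒮 ⊆ {S ∈ powersetCard k (univ : Finset (Fin n)) | R ⊆ S}) :
    #{p ∈ 𝒮 ×ˢ 𝒮 | 2 ≤ #(p.1 ∩ p.2)} ≤ n ^ (k - #R) * (k.choose 2 * n ^ (k - 2)) := by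
  have hsub : {p ∈ 𝒮 ×ˢ 𝒮 | 2 ≤ #(p.1 ∩ p.2)} ⊆
      𝒮.biUnion fun S => (powersetCard 2 S).biUnion fun U =>
        {T ∈ powersetCard k (univ : Finset (Fin n)) | U ⊆ T}.image fun T => (S, T) := by
    rintro ⟨S, T⟩ hp
    simp only [mem_filter, mem_product] at hp
    obtain ⟨U, hU, hc⟩ := exists_subset_card_eq hp.2
    simp only [mem_biUnion, mem_image, mem_filter, mem_powersetCard]
    have hT := h𝒮 hp.1.2
    simp only [mem_filter, mem_powersetCard] at hT
    exact ⟨S, hp.1.1, U, ⟨hU.trans inter_subset_left, hc⟩, T,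
      ⟨hT.1, hU.trans inter_subset_right⟩, rfl⟩
  refine (card_le_card hsub).trans ?_
  refine (card_biUnion_le_card_mul _ _ (k.choose 2 * n ^ (k - 2)) fun S hS => ?_).trans ?_
  · have hSk : #S = k := by
      have := h𝒮 hS
      simp only [mem_filter, mem_powersetCard] at this
      exact this.1.2
    refine (card_biUnion_le_card_mul _ _ (n ^ (k - 2)) fun U hU => ?_).trans ?_
    · refine card_image_le.trans ?_
      have := card_supersets_le k U
      rwa [(mem_powersetCard.1 hU).2] at this
    · rw [card_powersetCard, hSk]
  · exact Nat.mul_le_mul_right _ ((card_le_card h𝒮).trans (card_supersets_le k R))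

lemma choose_le_card_supersets (k : ℕ) (s : Fin n) :
    (n - 1).choose k ≤ #{S ∈ powersetCard (k + 1) (univ : Finset (Fin n)) | {s} ⊆ S} := by
  have h : #(powersetCard k ((univ : Finset (Fin n)).erase s)) = (n - 1).choose k := by
    rw [card_powersetCard, card_erase_of_mem (mem_univ s), card_univ, Fintype.card_fin]
  rw [← h]
  refine card_le_card_of_injOn (fun S => insert s S) ?_ ?_
  · intro S hS
    simp only [mem_coe, mem_powersetCard, subset_erase] at hS
    simp [card_insert_of_notMem hS.1.2, hS.2]
  · intro S hS T hT h
    simp only [mem_coe, mem_powersetCard, subset_erase] at hS hT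
    rw [← erase_insert hS.1.2, ← erase_insert hT.1.2]
    exact congrArg (fun X => X.erase s) h

/-! ### Chebyshev's inequality for weakly dependent sums over vertex sets -/

/-- If summands indexed by `k`-sets that contain `R` are bounded by `M`, and uncorrelated when their
index sets share at most one vertex, then their sum rarely exceeds `t`. -/
lemma chebyshev_sets (k : ℕ) (R : Finset (Fin n)) (𝒮 : Finset (Finset (Fin n)))
    (h𝒮 : 𝒮 ⊆ {S ∈ powersetCard k (univ : Finset (Fin n)) | R ⊆ S})
    (f : Finset (Fin n) → SimpleGraph (Fin n) → ℝ) (M t : ℝ) (hM : ∀ S ∈ 𝒮, ∀ G, |f S G| ≤ M)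
    (h0 : ∀ S ∈ 𝒮, ∀ T ∈ 𝒮, #(S ∩ T) ≤ 1 → ∑ G, f S G * f T G = 0) (ht : 0 < t) :
    (randomGraph n).real {G | t ≤ |∑ S ∈ 𝒮, f S G|} ≤
      M ^ 2 * (n ^ (k - #R) * (k.choose 2 * n ^ (k - 2))) / t ^ 2 := by
  obtain ⟨N, hN⟩ : ∃ N : ℝ, N = Fintype.card (SimpleGraph (Fin n)) := ⟨_, rfl⟩
  have hNpos : 0 < N := by rw [hN]; exact_mod_cast Fintype.card_pos
  rw [randomGraph_real_eq, ← hN, div_le_div_iff₀ hNpos (by positivity)]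
  set B : Finset (SimpleGraph (Fin n)) := {G | t ≤ |∑ S ∈ 𝒮, f S G|}
  have h1 : (#B : ℝ) * t ^ 2 ≤ ∑ G, (∑ S ∈ 𝒮, f S G) ^ 2 := by
    calc (#B : ℝ) * t ^ 2 = ∑ G ∈ B, t ^ 2 := by rw [sum_const, nsmul_eq_mul]
      _ ≤ ∑ G ∈ B, (∑ S ∈ 𝒮, f S G) ^ 2 := by
          refine sum_le_sum fun G hG => ?_
          rw [← sq_abs (∑ S ∈ 𝒮, f S G)]
          exact pow_le_pow_left₀ ht.le (by simpa [B] using hG) 2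
      _ ≤ _ := sum_le_sum_of_subset_of_nonneg (subset_univ _) fun _ _ _ => sq_nonneg _
  have h2 : ∑ G, (∑ S ∈ 𝒮, f S G) ^ 2 = ∑ p ∈ 𝒮 ×ˢ 𝒮, ∑ G, f p.1 G * f p.2 G := by
    rw [sum_comm]
    refine sum_congr rfl fun G _ => ?_
    rw [sq, sum_mul_sum, sum_product]
  have h3 : ∑ p ∈ 𝒮 ×ˢ 𝒮, ∑ G, f p.1 G * f p.2 G ≤
      ∑ p ∈ 𝒮 ×ˢ 𝒮 with 2 ≤ #(p.1 ∩ p.2), N * M ^ 2 := by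
    rw [sum_filter]
    refine sum_le_sum fun p hp => ?_
    rw [mem_product] at hp
    split_ifs with h
    · calc ∑ G, f p.1 G * f p.2 G ≤ ∑ G : SimpleGraph (Fin n), M ^ 2 := by
            refine sum_le_sum fun G _ => (le_abs_self _).trans ?_
            rw [abs_mul, sq]
            exact mul_le_mul (hM _ hp.1 G) (hM _ hp.2 G) (abs_nonneg _)
              ((abs_nonneg _).trans (hM _ hp.1 G))
        _ = N * M ^ 2 := by rw [sum_const, nsmul_eq_mul, card_univ, hN]
    · exact (h0 _ hp.1 _ hp.2 (by omega)).le
  rw [sum_const, nsmul_eq_mul] at h3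
  have h4 : (#{p ∈ 𝒮 ×ˢ 𝒮 | 2 ≤ #(p.1 ∩ p.2)} : ℝ) ≤
      n ^ (k - #R) * (k.choose 2 * n ^ (k - 2)) := by exact_mod_cast card_pairs_le k R 𝒮 h𝒮
  have h5 := mul_le_mul_of_nonneg_right h4 (by positivity : 0 ≤ N * M ^ 2)
  linarith

/-! ### Cliques and their edges -/

/-- The pairs of distinct vertices of `S`. -/
def pairs (S : Finset (Fin n)) : Finset (Sym2 (Fin n)) :=
  S.offDiag.image (Function.uncurry Sym2.mk)

lemma mk_mem_pairs {S : Finset (Fin n)} {a b : Fin n} :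
    s(a, b) ∈ pairs S ↔ a ∈ S ∧ b ∈ S ∧ a ≠ b := by
  simp only [pairs, mem_image, mem_offDiag, Prod.exists, Function.uncurry_apply_pair, Sym2.eq_iff]
  constructor
  · rintro ⟨x, y, ⟨hx, hy, hxy⟩, ⟨rfl, rfl⟩ | ⟨rfl, rfl⟩⟩
    · exact ⟨hx, hy, hxy⟩
    · exact ⟨hy, hx, hxy.symm⟩
  · rintro ⟨ha, hb, hab⟩
    exact ⟨a, b, ⟨ha, hb, hab⟩, Or.inl ⟨rfl, rfl⟩⟩

lemma not_isDiag_of_mem_pairs {S : Finset (Fin n)} : ∀ e ∈ pairs S, ¬ e.IsDiag := by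
  intro e
  induction e using Sym2.ind with
  | _ a b => intro h; simpa using (mk_mem_pairs.1 h).2.2

lemma card_pairs (S : Finset (Fin n)) : #(pairs S) = (#S).choose 2 :=
  Sym2.card_image_offDiag S

lemma isNClique_iff_pairs (G : SimpleGraph (Fin n)) {k : ℕ} {S : Finset (Fin n)} (hS : #S = k) :
    G.IsNClique k S ↔ ∀ e ∈ pairs S, e ∈ G.edgeSet := by
  rw [SimpleGraph.isNClique_iff, SimpleGraph.isClique_iff]
  constructor
  · rintro ⟨h, -⟩ e
    induction e using Sym2.ind with
    | _ a b =>
      intro he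
      obtain ⟨ha, hb, hab⟩ := mk_mem_pairs.1 he
      exact h ha hb hab
  · intro h
    exact ⟨fun a ha b hb hab => h _ (mk_mem_pairs.2 ⟨ha, hb, hab⟩), hS⟩

lemma disjoint_pairs {S T : Finset (Fin n)} (h : #(S ∩ T) ≤ 1) : Disjoint (pairs S) (pairs T) := by
  rw [Finset.disjoint_left]
  intro e
  induction e using Sym2.ind with
  | _ a b =>
    intro hS hT
    obtain ⟨ha, hb, hab⟩ := mk_mem_pairs.1 hS
    obtain ⟨ha', hb', -⟩ := mk_mem_pairs.1 hT
    exact hab (card_le_one.1 h a (mem_inter.2 ⟨ha, ha'⟩) b (mem_inter.2 ⟨hb, hb'⟩))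

/-- The indicator of the event that `S` is a `k`-clique. -/
noncomputable def cliqueInd (k : ℕ) (S : Finset (Fin n)) (G : SimpleGraph (Fin n)) : ℝ :=
  if G.IsNClique k S then 1 else 0

lemma sum_cliqueInd {k : ℕ} {S : Finset (Fin n)} (hS : #S = k) :
    ∑ G, cliqueInd k S G =
      Fintype.card (SimpleGraph (Fin n)) * (1 / 2) ^ k.choose 2 := by
  have h := sum_edges_present (pairs S) not_isDiag_of_mem_pairs
  rw [card_pairs, hS] at h
  rw [← h]
  exact sum_congr rfl fun G _ => if_congr (isNClique_iff_pairs G hS) rfl rfl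

lemma sum_cliqueInd_mul {k : ℕ} {S T : Finset (Fin n)} (hS : #S = k) (hT : #T = k)
    (h : #(S ∩ T) ≤ 1) :
    ∑ G, cliqueInd k S G * cliqueInd k T G =
      Fintype.card (SimpleGraph (Fin n)) * ((1 / 2) ^ k.choose 2) ^ 2 := by
  have h' := sum_edges_present (pairs S ∪ pairs T) fun e he =>
    (mem_union.1 he).elim (not_isDiag_of_mem_pairs e) (not_isDiag_of_mem_pairs e)
  rw [card_union_of_disjoint (disjoint_pairs h), card_pairs, card_pairs, hS, hT, pow_add,
    ← sq] at h'
  rw [← h']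
  refine sum_congr rfl fun G _ => ?_
  have hiff : (∀ e ∈ pairs S ∪ pairs T, e ∈ G.edgeSet) ↔ G.IsNClique k S ∧ G.IsNClique k T := by
    rw [isNClique_iff_pairs G hS, isNClique_iff_pairs G hT]
    exact forall_mem_union
  rw [cliqueInd, cliqueInd, if_congr hiff rfl rfl]
  by_cases h1 : G.IsNClique k S <;> by_cases h2 : G.IsNClique k T <;> simp [h1, h2]

/-- The finset of all `2d`-cliques of `G`. -/
noncomputable def cliques (G : SimpleGraph (Fin n)) (d : ℕ) : Finset (Finset (Fin n)) :=
  {S | G.IsNClique (2 * d) S}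

lemma mem_cliques {G : SimpleGraph (Fin n)} {d : ℕ} {S : Finset (Fin n)} :
    S ∈ cliques G d ↔ G.IsNClique (2 * d) S := by simp [cliques]

lemma cliqueDeg_eq_card (G : SimpleGraph (Fin n)) (d : ℕ) (I : Finset (Fin n)) :
    cliqueDeg G d I = #{S ∈ cliques G d | I ⊆ S} := by
  rw [cliqueDeg, ← Set.ncard_coe_finset]
  congr 1
  ext S
  simp [mem_cliques, and_comm]

lemma cliqueDeg_eq_sum_cliqueInd (G : SimpleGraph (Fin n)) (d : ℕ) (I : Finset (Fin n)) :
    (cliqueDeg G d I : ℝ) = ∑ S ∈ powersetCard (2 * d) (univ : Finset (Fin n)) with I ⊆ S,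
      cliqueInd (2 * d) S G := by
  simp only [cliqueInd]
  rw [cliqueDeg_eq_card, sum_boole, filter_filter]
  congr 2
  ext S
  simp only [mem_filter, mem_cliques, mem_powersetCard_univ]
  exact ⟨fun h => ⟨h.1.card_eq, h.2, h.1⟩, fun h => ⟨h.2.2, h.2.1⟩⟩

/-- Every vertex lies in a positive fraction of the possible `2d`-cliques, with probability
`1 - O(1/n)`, uniformly in the vertex. -/
lemma exists_cliqueDeg_lower (d : ℕ) (hd : 1 ≤ d) :
    ∃ c K : ℝ, 0 < c ∧ 0 ≤ K ∧ ∀ n : ℕ, 4 * d ≤ n → ∀ s : Fin n,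
      (randomGraph n).real {G | (cliqueDeg G d {s} : ℝ) < c * n ^ (2 * d - 1)} ≤ K / n := by
  set p : ℝ := (1 / 2) ^ (2 * d).choose 2 with hp
  have hp0 : 0 < p := by positivity
  have hp1 : p ≤ 1 := pow_le_one₀ (by norm_num) (by norm_num)
  set c : ℝ := p / (2 ^ (2 * d - 1) * (2 * d - 1).factorial) / 2 with hc
  have hc0 : 0 < c := by positivity
  refine ⟨c, (2 * d).choose 2 / c ^ 2, hc0, by positivity, fun n hn s => ?_⟩
  have hn0 : (0 : ℝ) < n := by exact_mod_cast (by omega : 0 < n)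
  set 𝒮 : Finset (Finset (Fin n)) := {S ∈ powersetCard (2 * d) (univ : Finset (Fin n)) | {s} ⊆ S}
    with h𝒮
  have hcard : ∀ S ∈ 𝒮, #S = 2 * d := fun S hS => by
    simp only [h𝒮, mem_filter, mem_powersetCard_univ] at hS
    exact hS.1
  -- the mean of `cliqueDeg G d {s}` is at least `2 * c * n ^ (2 * d - 1)`
  have hmean : 2 * c * n ^ (2 * d - 1) ≤ p * #𝒮 := by
    have h1 : ((n - 1).choose (2 * d - 1) : ℝ) ≤ #𝒮 := by
      have := choose_le_card_supersets (2 * d - 1) s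
      rw [Nat.sub_add_cancel (by omega : 1 ≤ 2 * d)] at this
      exact_mod_cast this
    have h2 := Nat.pow_le_choose (α := ℝ) (2 * d - 1) (n - 1)
    have h3 : (n : ℝ) / 2 ≤ ((n - 1 + 1 - (2 * d - 1) : ℕ) : ℝ) := by
      rw [div_le_iff₀ (by norm_num)]
      exact_mod_cast (by omega : n ≤ (n - 1 + 1 - (2 * d - 1)) * 2)
    have h4 : ((n : ℝ) / 2) ^ (2 * d - 1) / (2 * d - 1).factorial ≤ #𝒮 := by
      refine le_trans ?_ (h2.trans h1)
      gcongr
    calc 2 * c * n ^ (2 * d - 1)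
        = p * (((n : ℝ) / 2) ^ (2 * d - 1) / (2 * d - 1).factorial) := by
          rw [hc, div_pow]; field_simp
      _ ≤ p * #𝒮 := by gcongr
  have hcheb := chebyshev_sets (2 * d) {s} 𝒮 subset_rfl (fun S G => cliqueInd (2 * d) S G - p) 1
    (c * n ^ (2 * d - 1)) ?_ ?_ (by positivity)
  · refine (measureReal_mono ?_ (by
      have : IsProbabilityMeasure (randomGraph n) := by unfold randomGraph; infer_instance
      finiteness)).trans (hcheb.trans_eq ?_)
    · intro G hG
      simp only [Set.mem_ofPred_eq] at hG ⊢
      rw [sum_sub_distrib, sum_const, nsmul_eq_mul, ← cliqueDeg_eq_sum_cliqueInd, abs_sub_comm]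
      refine le_trans ?_ (le_abs_self _)
      linarith
    · rw [card_singleton, mul_pow, ← pow_mul]
      have e1 : (n : ℝ) ^ ((2 * d - 1) * 2) = n ^ (2 * d - 1) * n ^ (2 * d - 2) * n := by
        rw [← pow_add, ← pow_succ]; congr 1; omega
      rw [e1]
      field_simp
  · intro S _ G
    rw [cliqueInd, abs_le]
    split_ifs <;> constructor <;> linarith
  · intro S hS T hT hST
    have e : ∀ G, (cliqueInd (2 * d) S G - p) * (cliqueInd (2 * d) T G - p) =
        cliqueInd (2 * d) S G * cliqueInd (2 * d) T G - p * cliqueInd (2 * d) S G -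
          p * cliqueInd (2 * d) T G + p ^ 2 := fun G => by ring
    rw [sum_congr rfl fun G _ => e G, sum_add_distrib, sum_sub_distrib, sum_sub_distrib,
      ← mul_sum, ← mul_sum, sum_cliqueInd_mul (hcard S hS) (hcard T hT) hST,
      sum_cliqueInd (hcard S hS), sum_cliqueInd (hcard T hT), sum_const, nsmul_eq_mul, card_univ]
    ring

/-! ### Binomial weights -/

/-- The factor of the MPW moments that depends only on the size of the vertex set. -/
noncomputable def weight (d : ℕ) (ω : ℝ) (k : ℕ) : ℝ := Ring.choose ω k / ((2 * d).choose k : ℝ)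

lemma choose_real_eq (ω : ℝ) (k : ℕ) :
    Ring.choose ω k = (∏ j ∈ range k, (ω - j)) / k.factorial := by
  rw [Ring.choose_eq_smul, ← descPochhammer_eval_eq_prod_range, smul_eq_mul, inv_mul_eq_div,
    ← descPochhammer_map (Int.castRingHom ℝ), Polynomial.eval_map, Polynomial.eval₂_eq_sum,
    Polynomial.smeval_eq_sum]
  congr 1
  exact Finset.sum_congr rfl fun i _ => zsmul_eq_mul _ _

lemma weight_le_pow {d : ℕ} {ω : ℝ} {k : ℕ} (hk : k ≤ 2 * d) (hω : 4 * d ≤ ω) :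
    weight d ω k ≤ ω ^ k := by
  have hk' : (k : ℝ) ≤ 2 * d := by exact_mod_cast hk
  have h0 : (0 : ℝ) ≤ ω := le_trans (by positivity) hω
  have h1 : ∏ j ∈ range k, (ω - j) ≤ ω ^ k := by
    calc ∏ j ∈ range k, (ω - j) ≤ ∏ j ∈ range k, ω := by
          refine prod_le_prod (fun j hj => ?_) fun j _ => by simp
          have : (j : ℝ) < k := by exact_mod_cast mem_range.1 hj
          linarith
      _ = ω ^ k := by simp
  have h2 : (1 : ℝ) ≤ k.factorial := by exact_mod_cast Nat.one_le_iff_ne_zero.2 k.factorial_ne_zero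
  have h3 : (1 : ℝ) ≤ (2 * d).choose k := by exact_mod_cast Nat.choose_pos hk
  rw [weight, choose_real_eq, div_div]
  refine (div_le_div_of_nonneg_right h1 (by positivity)).trans (div_le_self (by positivity) ?_)
  nlinarith

lemma le_weight {d : ℕ} (hd : 1 ≤ d) {ω : ℝ} {k : ℕ} (hk : k ≤ 2 * d) (hω : 4 * d ≤ ω) :
    (1 / (4 * d)) ^ (2 * d) * ω ^ k ≤ weight d ω k := by
  have hk' : (k : ℝ) ≤ 2 * d := by exact_mod_cast hk
  have hd' : (1 : ℝ) ≤ d := by exact_mod_cast hd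
  have h0 : (0 : ℝ) ≤ ω := le_trans (by positivity) hω
  have h1 : (ω / 2) ^ k ≤ ∏ j ∈ range k, (ω - j) := by
    calc (ω / 2) ^ k = ∏ j ∈ range k, ω / 2 := by rw [prod_const, card_range]
      _ ≤ ∏ j ∈ range k, (ω - j) := by
          refine prod_le_prod (fun j _ => by positivity) fun j hj => ?_
          have : (j : ℝ) < k := by exact_mod_cast mem_range.1 hj
          linarith
  have h2 : (k.factorial * (2 * d).choose k : ℝ) ≤ (2 * d) ^ k := by
    exact_mod_cast (Nat.descFactorial_eq_factorial_mul_choose _ _).symm.trans_le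
      (Nat.descFactorial_le_pow _ _)
  have h3 : (0 : ℝ) < (2 * d).choose k := by exact_mod_cast Nat.choose_pos hk
  rw [weight, choose_real_eq, div_div]
  calc (1 / (4 * d : ℝ)) ^ (2 * d) * ω ^ k ≤ (1 / (4 * d : ℝ)) ^ k * ω ^ k := by
        refine mul_le_mul_of_nonneg_right ?_ (by positivity)
        refine pow_le_pow_of_le_one (by positivity) ?_ hk
        rw [div_le_one (by positivity)]; linarith
    _ = (ω / 2) ^ k / (2 * d) ^ k := by
        rw [← mul_pow, ← div_pow]; congr 1; field_simp; ring
    _ ≤ _ := by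
        refine div_le_div₀ ((by positivity : (0 : ℝ) ≤ (ω / 2) ^ k).trans h1) h1 (by positivity) h2

lemma weight_nonneg {d : ℕ} (hd : 1 ≤ d) {ω : ℝ} {k : ℕ} (hk : k ≤ 2 * d) (hω : 4 * d ≤ ω) :
    0 ≤ weight d ω k := by
  have h0 : (0 : ℝ) ≤ ω := le_trans (by positivity) hω
  exact le_trans (by positivity) (le_weight hd hk hω)

/-! ### Sign products and the off-diagonal part of the quadratic form -/

/-- The coefficient `∏ i ∈ I, r_s(i)` of the monomial `x_I`. -/
noncomputable def signProd (G : SimpleGraph (Fin n)) (s : Fin n) (I : Finset (Fin n)) : ℝ :=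
  ∏ i ∈ I, nbr G s i

lemma abs_nbr_le_one (G : SimpleGraph (Fin n)) (s i : Fin n) : |nbr G s i| ≤ 1 := by
  unfold nbr; split_ifs <;> simp

lemma abs_signProd_le_one (G : SimpleGraph (Fin n)) (s : Fin n) (I : Finset (Fin n)) :
    |signProd G s I| ≤ 1 := by
  rw [signProd, abs_prod]
  exact prod_le_one (fun _ _ => abs_nonneg _) fun i _ => abs_nbr_le_one G s i

lemma signProd_eq_zero (G : SimpleGraph (Fin n)) {s : Fin n} {I : Finset (Fin n)} (h : s ∈ I) :
    signProd G s I = 0 :=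
  prod_eq_zero h (by simp [nbr])

lemma signProd_eq_one {G : SimpleGraph (Fin n)} {s : Fin n} {S I : Finset (Fin n)}
    (hS : G.IsClique S) (hs : s ∈ S) (hI : I ⊆ S) (h : s ∉ I) : signProd G s I = 1 := by
  refine prod_eq_one fun i hi => ?_
  have hne : i ≠ s := fun e => h (e ▸ hi)
  rw [nbr, if_neg hne, if_pos (hS hs (hI hi) hne.symm)]

lemma signProd_nonneg {G : SimpleGraph (Fin n)} {s : Fin n} {S I : Finset (Fin n)}
    (hS : G.IsClique S) (hs : s ∈ S) (hI : I ⊆ S) : 0 ≤ signProd G s I := by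
  by_cases h : s ∈ I
  · rw [signProd_eq_zero G h]
  · rw [signProd_eq_one hS hs hI h]; exact zero_le_one

lemma nbr_toggle (G : SimpleGraph (Fin n)) {s w : Fin n} (hw : w ≠ s) (i : Fin n) :
    nbr (toggle s(s, w) G) s i = if i = w then -nbr G s i else nbr G s i := by
  have hd : ¬ (s(s, w)).IsDiag := by simpa using hw.symm
  have h := mem_edgeSet_toggle (f := s(s, i)) hd G
  rw [SimpleGraph.mem_edgeSet, SimpleGraph.mem_edgeSet] at h
  by_cases hi : i = w
  · subst hi
    simp only [ne_eq, not_true_eq_false, iff_false] at h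
    rw [if_pos rfl, nbr, nbr, if_neg hw, if_neg hw]
    by_cases hA : G.Adj s i
    · rw [if_pos hA, if_neg (by simpa [h] using hA)]
    · rw [if_neg hA, if_pos (h.2 hA), neg_neg]
  · have hne : s(s, i) ≠ s(s, w) := fun e => hi (Sym2.congr_right.1 e)
    simp only [hne, ne_eq, not_false_eq_true, iff_true] at h
    rw [if_neg hi, nbr, nbr, if_congr h rfl rfl]

lemma signProd_toggle (G : SimpleGraph (Fin n)) {s w : Fin n} (hw : w ≠ s)
    (I : Finset (Fin n)) :
    signProd (toggle s(s, w) G) s I = if w ∈ I then -signProd G s I else signProd G s I := by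
  unfold signProd
  rw [prod_congr rfl fun i _ => nbr_toggle G hw i]
  split_ifs with h
  · rw [← mul_prod_erase I _ h, ← mul_prod_erase I (nbr G s) h, if_pos rfl, neg_mul]
    congr 2
    exact prod_congr rfl fun i hi => if_neg (ne_of_mem_erase hi)
  · exact prod_congr rfl fun i hi => if_neg (ne_of_mem_of_not_mem hi h)

lemma cliqueInd_toggle (G : SimpleGraph (Fin n)) {k : ℕ} {s w : Fin n} (hw : w ≠ s)
    {S : Finset (Fin n)} (hS : #S = k) (hs : s ∉ S) :
    cliqueInd k S (toggle s(s, w) G) = cliqueInd k S G := by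
  have hd : ¬ (s(s, w)).IsDiag := by simpa using hw.symm
  unfold cliqueInd
  refine if_congr ?_ rfl rfl
  rw [isNClique_iff_pairs _ hS, isNClique_iff_pairs _ hS]
  refine forall₂_congr fun e he => ?_
  have hne : e ≠ s(s, w) := by
    rintro rfl
    exact hs (mk_mem_pairs.1 he).1
  rw [mem_edgeSet_toggle hd]
  simp [hne]

/-- The contribution to the value of `(∑ I, signProd G s I * x_I) ^ 2` of the pairs `I ≠ J` of
`d`-subsets of a `2d`-clique `S`. -/
noncomputable def offDiagForm (d : ℕ) (ω : ℝ) (s : Fin n) (S : Finset (Fin n))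
    (G : SimpleGraph (Fin n)) : ℝ :=
  ∑ p ∈ (powersetCard d S).offDiag,
    signProd G s p.1 * signProd G s p.2 * weight d ω #(p.1 ∪ p.2)

lemma card_powerset_product {d : ℕ} {S : Finset (Fin n)} (hS : #S = 2 * d) :
    #(S.powerset ×ˢ S.powerset) = 16 ^ d := by
  rw [card_product, card_powerset, hS, pow_mul, ← mul_pow]; norm_num

lemma abs_offDiagForm_le {d : ℕ} (hd : 1 ≤ d) {ω : ℝ} (hω : 4 * d ≤ ω) (s : Fin n)
    {S : Finset (Fin n)} (hS : #S = 2 * d) (G : SimpleGraph (Fin n)) :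
    |offDiagForm d ω s S G| ≤ 16 ^ d * ω ^ (2 * d) := by
  have hd' : (1 : ℝ) ≤ d := by exact_mod_cast hd
  have hω1 : 1 ≤ ω := by linarith
  have hsub : (powersetCard d S).offDiag ⊆ S.powerset ×ˢ S.powerset := by
    intro p hp
    simp only [mem_offDiag, mem_powersetCard] at hp
    simp [hp.1.1, hp.2.1.1]
  calc |offDiagForm d ω s S G|
      ≤ ∑ p ∈ (powersetCard d S).offDiag,
          |signProd G s p.1 * signProd G s p.2 * weight d ω #(p.1 ∪ p.2)| := abs_sum_le_sum_abs _ _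
    _ ≤ ∑ p ∈ (powersetCard d S).offDiag, ω ^ (2 * d) := by
        refine sum_le_sum fun p hp => ?_
        have hp' := hsub hp
        rw [mem_product, mem_powerset, mem_powerset] at hp'
        have hk : #(p.1 ∪ p.2) ≤ 2 * d := hS ▸ card_le_card (union_subset hp'.1 hp'.2)
        rw [abs_mul, abs_mul, abs_of_nonneg (weight_nonneg hd hk hω)]
        calc |signProd G s p.1| * |signProd G s p.2| * weight d ω #(p.1 ∪ p.2)
            ≤ 1 * 1 * ω ^ (2 * d) := by
              gcongr
              · exact weight_nonneg hd hk hω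
              · exact abs_signProd_le_one _ _ _
              · exact abs_signProd_le_one _ _ _
              · exact (weight_le_pow hk hω).trans (pow_le_pow_right₀ hω1 hk)
          _ = ω ^ (2 * d) := by ring
    _ = #(powersetCard d S).offDiag * ω ^ (2 * d) := by rw [sum_const, nsmul_eq_mul]
    _ ≤ 16 ^ d * ω ^ (2 * d) := by
        gcongr
        exact_mod_cast (card_le_card hsub).trans_eq (card_powerset_product hS)

/-- The off-diagonal contributions of two vertex sets that share at most one vertex are
uncorrelated: some vertex `w` of `I ∆ J` lies outside the second set, and switching the pair `sw`
changes the sign of the product. -/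
lemma sum_offDiagForm_mul_eq_zero {d : ℕ} (ω : ℝ) {s : Fin n} {S T : Finset (Fin n)}
    (hS : #S = 2 * d) (hT : #T = 2 * d) (hsS : s ∉ S) (hsT : s ∉ T) (hST : #(S ∩ T) ≤ 1) :
    ∑ G, (cliqueInd (2 * d) S G * offDiagForm d ω s S G) *
      (cliqueInd (2 * d) T G * offDiagForm d ω s T G) = 0 := by
  simp only [offDiagForm, mul_sum, sum_mul]
  rw [sum_comm]
  refine sum_eq_zero fun q hq => ?_
  rw [sum_comm]
  refine sum_eq_zero fun p hp => ?_
  simp only [mem_offDiag, mem_powersetCard] at hp hq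
  obtain ⟨⟨hp1, hc1⟩, ⟨hp2, hc2⟩, hne⟩ := hp
  obtain ⟨⟨hq1, -⟩, ⟨hq2, -⟩, -⟩ := hq
  obtain ⟨w, hw, hwS, hwT⟩ : ∃ w, (w ∈ p.1 ∧ w ∉ p.2 ∨ w ∈ p.2 ∧ w ∉ p.1) ∧ w ∈ S ∧ w ∉ T := by
    obtain ⟨a, ha, ha'⟩ := Finset.not_subset.1 fun h =>
      hne (eq_of_subset_of_card_le h (by omega))
    obtain ⟨b, hb, hb'⟩ := Finset.not_subset.1 fun h =>
      hne (eq_of_subset_of_card_le h (by omega)).symm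
    by_cases haT : a ∈ T
    · refine ⟨b, Or.inr ⟨hb, hb'⟩, hp2 hb, fun hbT => ?_⟩
      have := card_le_one.1 hST a (mem_inter.2 ⟨hp1 ha, haT⟩) b (mem_inter.2 ⟨hp2 hb, hbT⟩)
      exact hb' (this ▸ ha)
    · exact ⟨a, Or.inl ⟨ha, ha'⟩, hp1 ha, haT⟩
  have hws : w ≠ s := fun e => hsS (e ▸ hwS)
  refine sum_eq_zero_of_toggle s(s, w) _ fun G => ?_
  have hw1 : w ∉ q.1 := fun h => hwT (hq1 h)
  have hw2 : w ∉ q.2 := fun h => hwT (hq2 h)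
  rw [cliqueInd_toggle G hws hS hsS, cliqueInd_toggle G hws hT hsT]
  simp only [signProd_toggle G hws]
  rcases hw with ⟨h1, h2⟩ | ⟨h1, h2⟩ <;> simp only [h1, h2, hw1, hw2, if_true, if_false] <;> ring

/-- The total off-diagonal contribution of the cliques that avoid `s`. -/
noncomputable def offDiagSum (d : ℕ) (ω : ℝ) (s : Fin n) (G : SimpleGraph (Fin n)) : ℝ :=
  ∑ S ∈ powersetCard (2 * d) (univ : Finset (Fin n)) with s ∉ S,
    cliqueInd (2 * d) S G * offDiagForm d ω s S G

lemma offDiagSum_tail {d : ℕ} (hd : 1 ≤ d) {ω : ℝ} (hω : 4 * d ≤ ω) (s : Fin n) {t : ℝ}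
    (ht : 0 < t) :
    (randomGraph n).real {G | t ≤ |offDiagSum d ω s G|} ≤
      (16 ^ d * ω ^ (2 * d)) ^ 2 * (n ^ (2 * d) * ((2 * d).choose 2 * n ^ (2 * d - 2))) / t ^ 2 := by
  have hmem : ∀ S ∈ ({S ∈ powersetCard (2 * d) (univ : Finset (Fin n)) | s ∉ S} : Finset _),
      #S = 2 * d ∧ s ∉ S := by
    intro S hS
    simpa only [mem_filter, mem_powersetCard_univ] using hS
  have h := chebyshev_sets (2 * d) ∅ {S ∈ powersetCard (2 * d) (univ : Finset (Fin n)) | s ∉ S}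
    (by intro S hS; simpa using (hmem S hS).1)
    (fun S G => cliqueInd (2 * d) S G * offDiagForm d ω s S G) (16 ^ d * ω ^ (2 * d)) t ?_ ?_ ht
  · simpa only [card_empty, Nat.sub_zero, offDiagSum] using h
  · intro S hS G
    have h1 := abs_offDiagForm_le hd hω s (hmem S hS).1 G
    rw [abs_mul]
    refine le_trans (mul_le_of_le_one_left (abs_nonneg _) ?_) h1
    rw [cliqueInd]; split_ifs <;> simp
  · intro S hS T hT hST
    exact sum_offDiagForm_mul_eq_zero ω (hmem S hS).1 (hmem T hT).1 (hmem S hS).2 (hmem T hT).2 hST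

/-! ### The quadratic form of the moments -/

/-- The unnormalized quadratic form of the MPW moments, evaluated at the coefficient vector `v` of
a multilinear polynomial. -/
noncomputable def quadForm (G : SimpleGraph (Fin n)) (d : ℕ) (ω : ℝ) (v : Finset (Fin n) → ℝ) : ℝ :=
  ∑ I, ∑ J, v I * v J * (cliqueDeg G d (I ∪ J) * weight d ω #(I ∪ J))

/-- The contribution of a single clique `S` to `quadForm`. -/
noncomputable def localForm (d : ℕ) (ω : ℝ) (S : Finset (Fin n)) (v : Finset (Fin n) → ℝ) : ℝ :=
  ∑ p ∈ S.powerset ×ˢ S.powerset, v p.1 * v p.2 * weight d ω #(p.1 ∪ p.2)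

lemma quadForm_eq_sum_localForm (G : SimpleGraph (Fin n)) (d : ℕ) (ω : ℝ)
    (v : Finset (Fin n) → ℝ) :
    quadForm G d ω v = ∑ S ∈ cliques G d, localForm d ω S v := by
  have h1 : ∀ S : Finset (Fin n), localForm d ω S v =
      ∑ p : Finset (Fin n) × Finset (Fin n),
        if p.1 ∪ p.2 ⊆ S then v p.1 * v p.2 * weight d ω #(p.1 ∪ p.2) else 0 := by
    intro S
    rw [localForm, ← sum_filter]
    refine sum_congr ?_ fun _ _ => rfl
    ext p
    simp [union_subset_iff]
  simp only [h1]
  rw [sum_comm, quadForm, ← Fintype.sum_prod_type']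
  refine sum_congr rfl fun p _ => ?_
  rw [cliqueDeg_eq_card, ← sum_filter, sum_const, nsmul_eq_mul]
  ring

/-- The coefficient vector of `l * ∑ x_A - ∑ signProd G s I * x_I`, where `A` runs over the `a`-sets
that contain `s`, and `I` over the `d`-sets. -/
noncomputable def testVec (G : SimpleGraph (Fin n)) (d a : ℕ) (l : ℝ) (s : Fin n)
    (I : Finset (Fin n)) : ℝ :=
  (if s ∈ I ∧ #I = a then l else 0) - if #I = d then signProd G s I else 0

lemma localForm_testVec_of_mem {d a : ℕ} (hd : 1 ≤ d) (ha : 1 ≤ a) (had : a ≤ d) {ω l : ℝ}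
    (hω : 4 * d ≤ ω) (hl : 0 ≤ l) {G : SimpleGraph (Fin n)} {s : Fin n} {S : Finset (Fin n)}
    (hS : G.IsNClique (2 * d) S) (hs : s ∈ S) :
    localForm d ω S (testVec G d a l s) ≤
      16 ^ d * (l ^ 2 * ω ^ (2 * a - 1) + ω ^ (2 * d - 1)) -
        l * ((1 / (4 * d)) ^ (2 * d) * ω ^ (a + d)) * 2 := by
  have hd' : (1 : ℝ) ≤ d := by exact_mod_cast hd
  have hω1 : 1 ≤ ω := by linarith
  set α : Finset (Fin n) → ℝ := fun I => if s ∈ I ∧ #I = a then 1 else 0 with hα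
  set ρ : Finset (Fin n) → ℝ := fun I => if #I = d then signProd G s I else 0 with hρ
  have hα0 : ∀ I, 0 ≤ α I := fun I => by simp only [hα]; split_ifs <;> simp
  have hρ0 : ∀ I ⊆ S, 0 ≤ ρ I := fun I hI => by
    simp only [hρ]; split_ifs
    exacts [signProd_nonneg hS.isClique hs hI, le_rfl]
  have hw : ∀ p ∈ S.powerset ×ˢ S.powerset, p.1 ⊆ S ∧ p.2 ⊆ S ∧ #(p.1 ∪ p.2) ≤ 2 * d := by
    intro p hp
    rw [mem_product, mem_powerset, mem_powerset] at hp
    exact ⟨hp.1, hp.2, hS.card_eq ▸ card_le_card (union_subset hp.1 hp.2)⟩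
  have hpow : ∀ {k m : ℕ}, k ≤ m → k ≤ 2 * d → weight d ω k ≤ ω ^ m := fun hk hk' =>
    (weight_le_pow hk' hω).trans (pow_le_pow_right₀ hω1 hk)
  have hcard : (#(S.powerset ×ˢ S.powerset) : ℝ) = 16 ^ d := by
    exact_mod_cast card_powerset_product hS.card_eq
  have h1 : ∑ p ∈ S.powerset ×ˢ S.powerset, α p.1 * α p.2 * weight d ω #(p.1 ∪ p.2) ≤
      16 ^ d * ω ^ (2 * a - 1) := by
    rw [← hcard, ← nsmul_eq_mul]
    refine sum_le_card_nsmul _ _ _ fun p hp => ?_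
    simp only [hα]
    split_ifs with h h'
    · rw [one_mul, one_mul]
      refine hpow ?_ (hw p hp).2.2
      have h3 := card_union_add_card_inter p.1 p.2
      have h4 : 0 < #(p.1 ∩ p.2) := card_pos.2 ⟨s, mem_inter.2 ⟨h.1, h'.1⟩⟩
      omega
    all_goals simp only [mul_zero, zero_mul]; positivity
  have h2 : ∑ p ∈ S.powerset ×ˢ S.powerset, ρ p.1 * ρ p.2 * weight d ω #(p.1 ∪ p.2) ≤
      16 ^ d * ω ^ (2 * d - 1) := by
    rw [← hcard, ← nsmul_eq_mul]
    refine sum_le_card_nsmul _ _ _ fun p hp => ?_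
    by_cases h : s ∈ p.1 ∪ p.2
    · have h0 : ρ p.1 * ρ p.2 = 0 := by
        rcases mem_union.1 h with h | h <;> simp [hρ, signProd_eq_zero G h]
      rw [h0, zero_mul]; positivity
    · have hk : #(p.1 ∪ p.2) ≤ 2 * d - 1 := by
        have : #(p.1 ∪ p.2) ≤ #(S.erase s) := card_le_card <|
          subset_erase.2 ⟨union_subset (hw p hp).1 (hw p hp).2.1, h⟩
        rwa [card_erase_of_mem hs, hS.card_eq] at this
      have hρ1 : ∀ I, ρ I ≤ 1 := fun I => by
        simp only [hρ]; split_ifs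
        exacts [(le_abs_self _).trans (abs_signProd_le_one _ _ _), zero_le_one]
      calc ρ p.1 * ρ p.2 * weight d ω #(p.1 ∪ p.2) ≤ 1 * 1 * ω ^ (2 * d - 1) :=
            mul_le_mul (mul_le_mul (hρ1 _) (hρ1 _) (hρ0 _ (hw p hp).2.1) zero_le_one)
              (hpow hk (hw p hp).2.2) (weight_nonneg hd (hw p hp).2.2 hω) (by norm_num)
        _ = ω ^ (2 * d - 1) := by ring
  -- a single pair of disjoint sets already gives the lower bound for the mixed terms
  have h3 : (1 / (4 * d)) ^ (2 * d) * ω ^ (a + d) ≤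
      ∑ p ∈ S.powerset ×ˢ S.powerset, α p.1 * ρ p.2 * weight d ω #(p.1 ∪ p.2) := by
    obtain ⟨A, hA1, hA2, hA3⟩ := exists_subsuperset_card_eq (singleton_subset_iff.2 hs)
      (by simpa using ha : #{s} ≤ a) (by rw [hS.card_eq]; omega : a ≤ #S)
    have hsA : s ∈ A := singleton_subset_iff.1 hA1
    obtain ⟨J, hJ1, hJ2⟩ := exists_subset_card_eq
      (by rw [card_sdiff_of_subset hA2, hS.card_eq]; omega : d ≤ #(S \ A))
    have hJS : J ⊆ S := hJ1.trans sdiff_subset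
    have hsJ : s ∉ J := fun h => (mem_sdiff.1 (hJ1 h)).2 hsA
    have hAJ : #(A ∪ J) = a + d := by
      rw [card_union_of_disjoint (disjoint_sdiff.mono_right hJ1), hA3, hJ2]
    have hmem : (A, J) ∈ S.powerset ×ˢ S.powerset := by simp [hA2, hJS]
    refine le_trans ?_ (single_le_sum (fun p hp => ?_) hmem)
    · have e1 : α A = 1 := if_pos ⟨hsA, hA3⟩
      have e2 : ρ J = 1 := by
        simp only [hρ]; rw [if_pos hJ2, signProd_eq_one hS.isClique hs hJS hsJ]
      simp only [e1, e2, one_mul, hAJ]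
      exact le_weight hd (by omega) hω
    · exact mul_nonneg (mul_nonneg (hα0 _) (hρ0 _ (hw p hp).2.1))
        (weight_nonneg hd (hw p hp).2.2 hω)
  have hswap : ∑ p ∈ S.powerset ×ˢ S.powerset, ρ p.1 * α p.2 * weight d ω #(p.1 ∪ p.2) =
      ∑ p ∈ S.powerset ×ˢ S.powerset, α p.1 * ρ p.2 * weight d ω #(p.1 ∪ p.2) := by
    rw [sum_product, sum_product_right]
    refine sum_congr rfl fun I _ => sum_congr rfl fun J _ => ?_
    rw [union_comm, mul_comm (ρ I)]
  have hexp : localForm d ω S (testVec G d a l s) =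
      l ^ 2 * ∑ p ∈ S.powerset ×ˢ S.powerset, α p.1 * α p.2 * weight d ω #(p.1 ∪ p.2) -
      l * (∑ p ∈ S.powerset ×ˢ S.powerset, α p.1 * ρ p.2 * weight d ω #(p.1 ∪ p.2)) -
      l * (∑ p ∈ S.powerset ×ˢ S.powerset, ρ p.1 * α p.2 * weight d ω #(p.1 ∪ p.2)) +
      ∑ p ∈ S.powerset ×ˢ S.powerset, ρ p.1 * ρ p.2 * weight d ω #(p.1 ∪ p.2) := by
    rw [localForm, mul_sum, mul_sum, mul_sum, ← sum_sub_distrib, ← sum_sub_distrib,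
      ← sum_add_distrib]
    refine sum_congr rfl fun p _ => ?_
    have hv : ∀ I, testVec G d a l s I = l * α I - ρ I := fun I => by
      simp only [testVec, hα, hρ, mul_ite, mul_one, mul_zero]
    rw [hv, hv]
    ring
  rw [hexp, hswap]
  have h1' := mul_le_mul_of_nonneg_left h1 (sq_nonneg l)
  have h3' := mul_le_mul_of_nonneg_left h3 hl
  linarith

lemma localForm_testVec_of_notMem {d : ℕ} (hd : 1 ≤ d) (a : ℕ) {ω : ℝ} (l : ℝ)
    (hω : 4 * d ≤ ω) (G : SimpleGraph (Fin n)) {s : Fin n} {S : Finset (Fin n)}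
    (hS : #S = 2 * d) (hs : s ∉ S) :
    localForm d ω S (testVec G d a l s) ≤ 16 ^ d * ω ^ d + offDiagForm d ω s S G := by
  have hd' : (1 : ℝ) ≤ d := by exact_mod_cast hd
  have hω1 : 1 ≤ ω := by linarith
  have h1 : localForm d ω S (testVec G d a l s) =
      ∑ p ∈ powersetCard d S ×ˢ powersetCard d S,
        signProd G s p.1 * signProd G s p.2 * weight d ω #(p.1 ∪ p.2) := by
    symm
    refine sum_subset_zero_on_sdiff
      (product_subset_product (fun I hI => mem_powerset.2 (mem_powersetCard.1 hI).1)
        fun I hI => mem_powerset.2 (mem_powersetCard.1 hI).1) ?_ ?_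
    · intro p hp
      simp only [Finset.mem_sdiff, mem_product, mem_powerset, mem_powersetCard] at hp
      have h1 : s ∉ p.1 := fun h => hs (hp.1.1 h)
      have h2 : s ∉ p.2 := fun h => hs (hp.1.2 h)
      simp only [testVec, h1, h2, false_and, if_false]
      by_cases e1 : #p.1 = d
      · have e2 : #p.2 ≠ d := fun e2 => hp.2 ⟨⟨hp.1.1, e1⟩, hp.1.2, e2⟩
        simp [e2]
      · simp [e1]
    · intro p hp
      simp only [mem_product, mem_powersetCard] at hp
      have h1 : s ∉ p.1 := fun h => hs (hp.1.1 h)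
      have h2 : s ∉ p.2 := fun h => hs (hp.2.1 h)
      simp only [testVec, h1, h2, false_and, if_false, hp.1.2, hp.2.2, if_true]
      ring
  rw [h1, ← diag_union_offDiag, sum_union (disjoint_diag_offDiag _), sum_diag]
  refine add_le_add ?_ le_rfl
  have hle : #(powersetCard d S) ≤ 16 ^ d := by
    calc #(powersetCard d S) ≤ #S.powerset := 
          card_le_card fun I hI => mem_powerset.2 (mem_powersetCard.1 hI).1
      _ ≤ #(S.powerset ×ˢ S.powerset) := by
          rw [card_product]
          exact Nat.le_mul_of_pos_left _ (card_pos.2 (powerset_nonempty S))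
      _ = 16 ^ d := card_powerset_product hS
  calc ∑ I ∈ powersetCard d S, signProd G s I * signProd G s I * weight d ω #(I ∪ I)
      ≤ ∑ I ∈ powersetCard d S, ω ^ d := by
        refine sum_le_sum fun I hI => ?_
        rw [union_self, (mem_powersetCard.1 hI).2, ← abs_mul_abs_self (signProd G s I)]
        have h := abs_signProd_le_one G s I
        calc |signProd G s I| * |signProd G s I| * weight d ω d ≤ 1 * 1 * ω ^ d := by
              gcongr
              · exact weight_nonneg hd (by omega) hω
              · exact weight_le_pow (by omega) hω
          _ = ω ^ d := by ring
    _ = #(powersetCard d S) * ω ^ d := by rw [sum_const, nsmul_eq_mul]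
    _ ≤ 16 ^ d * ω ^ d := by
        gcongr
        exact_mod_cast hle

lemma quadForm_testVec_le {d a : ℕ} (hd : 1 ≤ d) (ha : 1 ≤ a) (had : a ≤ d) {ω l : ℝ}
    (hω : 4 * d ≤ ω) (hl : 0 ≤ l) (G : SimpleGraph (Fin n)) (s : Fin n) :
    quadForm G d ω (testVec G d a l s) ≤
      cliqueDeg G d {s} * (16 ^ d * (l ^ 2 * ω ^ (2 * a - 1) + ω ^ (2 * d - 1)) -
        l * ((1 / (4 * d)) ^ (2 * d) * ω ^ (a + d)) * 2) +
      n ^ (2 * d) * (16 ^ d * ω ^ d) + offDiagSum d ω s G := by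
  have h0 : (0 : ℝ) ≤ ω := le_trans (by positivity) hω
  rw [quadForm_eq_sum_localForm, ← sum_filter_add_sum_filter_not (cliques G d) (fun S => s ∈ S),
    add_assoc]
  refine add_le_add ?_ ?_
  · have hD : cliqueDeg G d {s} = #{S ∈ cliques G d | s ∈ S} := by
      rw [cliqueDeg_eq_card]; simp only [singleton_subset_iff]
    rw [hD, ← nsmul_eq_mul]
    refine sum_le_card_nsmul _ _ _ fun S hS => ?_
    rw [mem_filter, mem_cliques] at hS
    exact localForm_testVec_of_mem hd ha had hω hl hS.1 hS.2
  · have hQ : offDiagSum d ω s G =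
        ∑ S ∈ cliques G d with s ∉ S, offDiagForm d ω s S G := by
      have hf : ({S ∈ cliques G d | s ∉ S} : Finset (Finset (Fin n))) =
          {S ∈ ({S ∈ powersetCard (2 * d) (univ : Finset (Fin n)) | s ∉ S} : Finset _) |
            G.IsNClique (2 * d) S} := by
        ext S
        simp only [mem_filter, mem_cliques, mem_powersetCard_univ]
        exact ⟨fun h => ⟨⟨h.1.card_eq, h.2⟩, h.1⟩, fun h => ⟨h.2, h.1.2⟩⟩
      rw [offDiagSum, hf, sum_filter (fun S => G.IsNClique (2 * d) S)]
      refine sum_congr rfl fun S _ => ?_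
      rw [cliqueInd]
      split_ifs <;> simp
    have hcard : #{S ∈ cliques G d | s ∉ S} ≤ n ^ (2 * d) := by
      calc #{S ∈ cliques G d | s ∉ S} ≤ #(powersetCard (2 * d) (univ : Finset (Fin n))) :=
            card_le_card fun S hS => by
              rw [mem_filter, mem_cliques] at hS
              exact mem_powersetCard_univ.2 hS.1.card_eq
        _ ≤ n ^ (2 * d) := by
            rw [card_powersetCard, card_univ, Fintype.card_fin]
            exact Nat.choose_le_pow _ _
    calc ∑ S ∈ cliques G d with s ∉ S, localForm d ω S (testVec G d a l s)
        ≤ ∑ S ∈ cliques G d with s ∉ S, (16 ^ d * ω ^ d + offDiagForm d ω s S G) := by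
          refine sum_le_sum fun S hS => ?_
          rw [mem_filter, mem_cliques] at hS
          exact localForm_testVec_of_notMem hd a l hω G hS.1.card_eq hS.2
      _ = #{S ∈ cliques G d | s ∉ S} * (16 ^ d * ω ^ d) + offDiagSum d ω s G := by
          rw [sum_add_distrib, sum_const, nsmul_eq_mul, hQ]
      _ ≤ n ^ (2 * d) * (16 ^ d * ω ^ d) + offDiagSum d ω s G := by
          gcongr
          exact_mod_cast hcard

/-! ### Negativity of the quadratic form with high probability -/

/-- The constant of the test polynomial: the minimizer in `C` of `16 ^ d * C ^ 2 - 2 * κ * C`, where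
`κ = (1 / (4 d)) ^ (2 d)` is the lower bound for the weights. -/
noncomputable def testConst (d : ℕ) : ℝ := (1 / (4 * d)) ^ (2 * d) / 16 ^ d

lemma testConst_pos {d : ℕ} (hd : 1 ≤ d) : 0 < testConst d := by
  have : (0 : ℝ) < d := by exact_mod_cast hd
  unfold testConst; positivity

/-- With `δ = testConst d ^ 2 * 16 ^ d * c / 4`, a lower bound `c * n ^ (2d-1)` for the number of
cliques at `s` beats the diagonal and the off-diagonal terms. -/
lemma quadForm_testVec_neg {d a : ℕ} (hd : 1 ≤ d) (ha : 1 ≤ a) (had : a ≤ d) {ω c δ : ℝ}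
    (hω : 4 * d ≤ ω) (hω2 : 2 ≤ testConst d ^ 2 * ω ^ 2) (hn : 0 < n)
    (hδ : δ = testConst d ^ 2 * 16 ^ d * c / 4) (hωn : 16 ^ d * n ≤ δ * ω ^ (d + 1))
    (G : SimpleGraph (Fin n)) (s : Fin n) (hdeg : c * n ^ (2 * d - 1) ≤ cliqueDeg G d {s})
    (hQ : |offDiagSum d ω s G| < δ * ω ^ (2 * d + 1) * n ^ (2 * d - 1)) :
    quadForm G d ω (testVec G d a (testConst d * ω ^ (d + 1 - a)) s) < 0 := by
  have hd' : (1 : ℝ) ≤ d := by exact_mod_cast hd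
  have hω0 : 0 < ω := by linarith
  have hC := testConst_pos hd
  refine (quadForm_testVec_le hd ha had hω (by positivity) G s).trans_lt ?_
  have hκ : (1 / (4 * d : ℝ)) ^ (2 * d) = testConst d * 16 ^ d := by
    rw [testConst]; field_simp
  rw [hκ]
  set C := testConst d
  set D : ℝ := ((cliqueDeg G d {s} : ℕ) : ℝ)
  set W : ℝ := ω ^ (2 * d - 1) with hW
  have hW0 : 0 < W := by positivity
  have e1 : (C * ω ^ (d + 1 - a)) ^ 2 * ω ^ (2 * a - 1) = C ^ 2 * (W * ω ^ 2) := by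
    rw [mul_pow, ← pow_mul, mul_assoc, ← pow_add, hW, ← pow_add]
    congr 2; omega
  have e2 : (C * ω ^ (d + 1 - a)) * (C * 16 ^ d * ω ^ (a + d)) = C ^ 2 * 16 ^ d * (W * ω ^ 2) := by
    have : ω ^ (d + 1 - a) * ω ^ (a + d) = W * ω ^ 2 := by
      rw [← pow_add, hW, ← pow_add]; congr 1; omega
    rw [← this]; ring
  have e3 : ω ^ (2 * d + 1) = W * ω ^ 2 := by
    rw [hW, ← pow_add]; congr 1; omega
  have e4 : ω ^ d * ω ^ (d + 1) = W * ω ^ 2 := by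
    rw [hW, ← pow_add, ← pow_add]; congr 1; omega
  have e5 : (n : ℝ) ^ (2 * d) = n ^ (2 * d - 1) * n := by
    rw [← pow_succ]; congr 1; omega
  rw [e1, e2, e5]
  rw [e3] at hQ
  have hmain : 16 ^ d * (C ^ 2 * (W * ω ^ 2) + W) - C ^ 2 * 16 ^ d * (W * ω ^ 2) * 2 ≤
      -(C ^ 2 * 16 ^ d / 2 * (W * ω ^ 2)) := by
    have : 0 ≤ 16 ^ d * W * (C ^ 2 * ω ^ 2 - 2) := by
      have := sub_nonneg.2 hω2
      positivity
    linarith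
  have h1 : D * (16 ^ d * (C ^ 2 * (W * ω ^ 2) + W) - C ^ 2 * 16 ^ d * (W * ω ^ 2) * 2) ≤
      -(2 * δ * (W * ω ^ 2) * n ^ (2 * d - 1)) := by
    calc _ ≤ D * -(C ^ 2 * 16 ^ d / 2 * (W * ω ^ 2)) :=
          mul_le_mul_of_nonneg_left hmain (Nat.cast_nonneg _)
      _ = -(D * (C ^ 2 * 16 ^ d / 2 * (W * ω ^ 2))) := by ring
      _ ≤ -(c * n ^ (2 * d - 1) * (C ^ 2 * 16 ^ d / 2 * (W * ω ^ 2))) := by gcongr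
      _ = _ := by rw [hδ]; ring
  have h2 : (n : ℝ) ^ (2 * d - 1) * n * (16 ^ d * ω ^ d) ≤ δ * (W * ω ^ 2) * n ^ (2 * d - 1) := by
    calc (n : ℝ) ^ (2 * d - 1) * n * (16 ^ d * ω ^ d)
        = n ^ (2 * d - 1) * ω ^ d * (16 ^ d * n) := by ring
      _ ≤ n ^ (2 * d - 1) * ω ^ d * (δ * ω ^ (d + 1)) := by gcongr
      _ = δ * (W * ω ^ 2) * n ^ (2 * d - 1) := by rw [← e4]; ring
  have h3 := (le_abs_self (offDiagSum d ω s G)).trans_lt hQ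
  linarith

lemma eventually_growth (d : ℕ) {ω : ℕ → ℝ}
    (hω : Tendsto (fun n : ℕ => ω n / (n : ℝ) ^ ((1 : ℝ) / ((d : ℝ) + 1))) atTop atTop) (M : ℝ) :
    ∀ᶠ n : ℕ in atTop, M ≤ ω n ∧ M * n ≤ ω n ^ (d + 1) := by
  filter_upwards [hω.eventually_ge_atTop (max M 1), eventually_ge_atTop 1] with n h1 hn
  have hn' : (1 : ℝ) ≤ n := by exact_mod_cast hn
  set x : ℝ := (n : ℝ) ^ ((1 : ℝ) / ((d : ℝ) + 1)) with hx
  have hx1 : 1 ≤ x := Real.one_le_rpow hn' (by positivity)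
  have hxn : x ^ (d + 1) = n := by
    rw [hx, ← Real.rpow_natCast, ← Real.rpow_mul (by positivity)]
    push_cast
    rw [one_div_mul_cancel (by positivity), Real.rpow_one]
  set m := max M 1
  have hm1 : 1 ≤ m := le_max_right _ _
  rw [le_div_iff₀ (by linarith)] at h1
  refine ⟨(le_max_left M 1).trans ((le_mul_of_one_le_right (by linarith) hx1).trans h1), ?_⟩
  calc M * n ≤ m ^ (d + 1) * n := by
        gcongr
        exact (le_max_left M 1).trans (le_self_pow₀ hm1 (by omega))
    _ = (m * x) ^ (d + 1) := by rw [mul_pow, hxn]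
    _ ≤ ω n ^ (d + 1) := by gcongr

/-- For `ω ≫ n ^ (1 / (d + 1))` the quadratic form is negative at the test vector with probability
tending to `1`, uniformly in the vertex. -/
lemma quadForm_testVec_neg_whp {d a : ℕ} (hd : 1 ≤ d) (ha : 1 ≤ a) (had : a ≤ d) {ω : ℕ → ℝ}
    (hω : Tendsto (fun n : ℕ => ω n / (n : ℝ) ^ ((1 : ℝ) / ((d : ℝ) + 1))) atTop atTop)
    {ε : ℝ} (hε : 0 < ε) :
    ∀ᶠ n : ℕ in atTop, ∀ s : Fin n,
      1 - ε ≤ (randomGraph n).real {G | 0 < cliqueDeg G d {s} ∧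
        quadForm G d (ω n) (testVec G d a (testConst d * ω n ^ (d + 1 - a)) s) < 0} := by
  obtain ⟨c, K, hc, hK, hdeg⟩ := exists_cliqueDeg_lower d hd
  have hC := testConst_pos hd
  set δ : ℝ := testConst d ^ 2 * 16 ^ d * c / 4 with hδ
  have hδ0 : 0 < δ := by positivity
  -- the tail of the off-diagonal sum is at most `L / ω ^ 2`
  set L : ℝ := (16 ^ d) ^ 2 * (2 * d).choose 2 / δ ^ 2 with hL
  have hL0 : 0 ≤ L := by positivity
  set M : ℝ := 1 + 4 * d + 2 / testConst d ^ 2 + 16 ^ d / δ + 2 * L / ε with hM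
  have hg := eventually_growth d hω M
  have hKn : ∀ᶠ n : ℕ in atTop, K / n ≤ ε / 2 := by
    have h := tendsto_const_div_atTop_nhds_zero_nat K
    exact (h.eventually (gt_mem_nhds (half_pos hε))).mono fun n hn => hn.le
  filter_upwards [hg, hKn, eventually_ge_atTop (4 * d)] with n hgn hKn hn s
  obtain ⟨hω1, hωn⟩ := hgn
  have hn0 : 0 < n := by omega
  have hn' : (0 : ℝ) < n := by exact_mod_cast hn0
  have b1 : 0 ≤ 2 / testConst d ^ 2 := by positivity
  have b2 : 0 ≤ 16 ^ d / δ := by positivity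
  have b3 : 0 ≤ 2 * L / ε := by positivity
  have b4 : (0 : ℝ) ≤ 4 * d := by positivity
  have hw1 : 1 ≤ ω n := by linarith
  have hw4 : 4 * d ≤ ω n := by linarith
  have hsq : ω n ≤ ω n ^ 2 := le_self_pow₀ hw1 (by norm_num)
  have hw2 : 2 ≤ testConst d ^ 2 * ω n ^ 2 := by
    have : 2 / testConst d ^ 2 ≤ ω n ^ 2 := by linarith
    rwa [div_le_iff₀' (by positivity)] at this
  have hw3 : 16 ^ d * n ≤ δ * ω n ^ (d + 1) := by
    have h1 : 16 ^ d / δ * n ≤ ω n ^ (d + 1) := by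
      refine le_trans ?_ hωn
      gcongr
      linarith
    calc 16 ^ d * (n : ℝ) = δ * (16 ^ d / δ * n) := by field_simp
      _ ≤ δ * ω n ^ (d + 1) := by gcongr
  have htail := offDiagSum_tail hd hw4 s
    (by positivity : 0 < δ * ω n ^ (2 * d + 1) * n ^ (2 * d - 1))
  have htail' : (randomGraph n).real
      {G | δ * ω n ^ (2 * d + 1) * n ^ (2 * d - 1) ≤ |offDiagSum d (ω n) s G|} ≤ ε / 2 := by
    refine htail.trans ?_
    have e : (16 ^ d * ω n ^ (2 * d)) ^ 2 *
        ((n : ℝ) ^ (2 * d) * ((2 * d).choose 2 * n ^ (2 * d - 2))) /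
        (δ * ω n ^ (2 * d + 1) * n ^ (2 * d - 1)) ^ 2 = L / ω n ^ 2 := by
      have e1 : (n : ℝ) ^ (2 * d) * ((2 * d).choose 2 * n ^ (2 * d - 2)) =
          (2 * d).choose 2 * (n ^ (2 * d - 1)) ^ 2 := by
        have : (n : ℝ) ^ (2 * d) * n ^ (2 * d - 2) = (n ^ (2 * d - 1)) ^ 2 := by
          rw [← pow_add, ← pow_mul]; congr 1; omega
        rw [← this]; ring
      rw [e1, hL, pow_succ (ω n) (2 * d)]
      field_simp
    rw [e, div_le_iff₀ (by positivity)]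
    have : 2 * L / ε ≤ ω n ^ 2 := by linarith
    rw [div_le_iff₀ hε] at this
    linarith
  have : IsProbabilityMeasure (randomGraph n) := by unfold randomGraph; infer_instance
  set A : Set (SimpleGraph (Fin n)) := {G | 0 < cliqueDeg G d {s} ∧
    quadForm G d (ω n) (testVec G d a (testConst d * ω n ^ (d + 1 - a)) s) < 0}
  have hcover : (Set.univ : Set (SimpleGraph (Fin n))) ⊆
      A ∪ ({G | (cliqueDeg G d {s} : ℝ) < c * n ^ (2 * d - 1)} ∪
        {G | δ * ω n ^ (2 * d + 1) * n ^ (2 * d - 1) ≤ |offDiagSum d (ω n) s G|}) := by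
    intro G _
    by_contra hG
    simp only [Set.mem_union, Set.mem_ofPred_eq, not_or, not_lt, not_le] at hG
    refine hG.1 ⟨?_, quadForm_testVec_neg hd ha had hw4 hw2 hn0 hδ hw3 G s hG.2.1 hG.2.2⟩
    have h : (0 : ℝ) < cliqueDeg G d {s} := lt_of_lt_of_le (by positivity) hG.2.1
    exact_mod_cast h
  have h1 := measureReal_mono (μ := randomGraph n) hcover (by finiteness)
  rw [probReal_univ] at h1
  have h2 := h1.trans ((measureReal_union_le _ _).trans (add_le_add le_rfl
    ((measureReal_union_le _ _).trans (add_le_add (hdeg n hn s) htail'))))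
  linarith

/-! ### The MPW operator and the moment matrix in terms of the quadratic form -/

lemma cliqueDeg_le_cliqueCount (G : SimpleGraph (Fin n)) (d : ℕ) (I : Finset (Fin n)) :
    cliqueDeg G d I ≤ cliqueCount G d :=
  Set.ncard_le_ncard (fun _ h => h.2) (Set.toFinite _)

lemma mpw_monomial (G : SimpleGraph (Fin n)) (d : ℕ) (ω : ℝ) (m : Fin n →₀ ℕ) (r : ℝ) :
    mpw G d ω (MvPolynomial.monomial m r) = r * mpwMoment G d ω m.support := by
  have h : MvPolynomial.monomial m r = r • MvPolynomial.basisMonomials (Fin n) ℝ m := by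
    rw [MvPolynomial.coe_basisMonomials, MvPolynomial.smul_monomial, smul_eq_mul, mul_one]
  rw [h, map_smul, mpw, Module.Basis.constr_basis, smul_eq_mul]

/-- The multilinear polynomial with coefficient vector `v`. -/
noncomputable def multilinear (v : Finset (Fin n) → ℝ) : MvPolynomial (Fin n) ℝ :=
  ∑ I, MvPolynomial.monomial (∑ i ∈ I, Finsupp.single i 1) (v I)

lemma mpw_multilinear_sq (G : SimpleGraph (Fin n)) (d : ℕ) (ω : ℝ) (v : Finset (Fin n) → ℝ) :
    mpw G d ω (multilinear v ^ 2) = quadForm G d ω v / cliqueCount G d := by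
  have hsupp : ∀ I : Finset (Fin n), (∑ i ∈ I, Finsupp.single i 1 : Fin n →₀ ℕ).support = I := by
    intro I
    ext j
    simp [Finsupp.finsetSum_apply, Finsupp.single_apply]
  rw [sq, multilinear, sum_mul_sum, map_sum, quadForm, sum_div]
  refine sum_congr rfl fun I _ => ?_
  rw [map_sum, sum_div]
  refine sum_congr rfl fun J _ => ?_
  have hadd : ∀ f g : Fin n →₀ ℕ, (f + g).support = f.support ∪ g.support := by
    intro f g; ext j; simp; omega
  rw [MvPolynomial.monomial_mul, mpw_monomial, hadd, hsupp, hsupp, mpwMoment, weight]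
  ring

lemma kelnerPoly_eq_multilinear (G : SimpleGraph (Fin n)) (d : ℕ) (ω C : ℝ) (s : Fin n) :
    kelnerPoly G d ω C s = multilinear (testVec G d 1 (C * ω ^ d) s) := by
  have hmono : ∀ (I : Finset (Fin n)) (r : ℝ),
      MvPolynomial.monomial (∑ i ∈ I, Finsupp.single i 1) r =
        MvPolynomial.C r * ∏ i ∈ I, (MvPolynomial.X i : MvPolynomial (Fin n) ℝ) := by
    intro I r
    rw [MvPolynomial.monomial_eq, Finsupp.prod_fintype _ _ (by simp)]
    congr 1
    simp [Finsupp.finsetSum_apply, Finsupp.single_apply, prod_ite_mem]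
  have h1 : ∀ I : Finset (Fin n), (s ∈ I ∧ #I = 1) ↔ I = {s} := by
    intro I
    constructor
    · rintro ⟨hs, hI⟩
      obtain ⟨b, rfl⟩ := card_eq_one.1 hI
      rw [mem_singleton.1 hs]
    · rintro rfl; simp
  simp only [multilinear, testVec, h1, map_sub, sum_sub_distrib]
  rw [kelnerPoly]
  congr 1
  · rw [sum_eq_single {s} (fun I _ hI => by rw [if_neg hI, map_zero]) (by simp), hmono,
      if_pos rfl, prod_singleton]
  · rw [← sum_subset (subset_univ (powersetCard d (univ : Finset (Fin n))))
      fun I _ hI => by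
        rw [if_neg (fun h => hI (mem_powersetCard_univ.2 h)), map_zero]]
    refine sum_congr rfl fun I hI => ?_
    rw [hmono, if_pos (mem_powersetCard_univ.1 hI), signProd, prod_mul_distrib, map_prod]

lemma totalDegree_kelnerPoly_le (G : SimpleGraph (Fin n)) {d : ℕ} (hd : 1 ≤ d) (ω C : ℝ)
    (s : Fin n) : (kelnerPoly G d ω C s).totalDegree ≤ d := by
  refine (MvPolynomial.totalDegree_sub _ _).trans (max_le ?_ ?_)
  · refine (MvPolynomial.totalDegree_mul _ _).trans ?_
    rwa [MvPolynomial.totalDegree_C, MvPolynomial.totalDegree_X, zero_add]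
  · refine MvPolynomial.totalDegree_finsetSum_le fun I hI => ?_
    refine (MvPolynomial.totalDegree_finsetProd _ _).trans ?_
    calc ∑ i ∈ I, (MvPolynomial.C (nbr G s i) * MvPolynomial.X i :
            MvPolynomial (Fin n) ℝ).totalDegree ≤ ∑ i ∈ I, 1 := by
          refine sum_le_sum fun i _ => (MvPolynomial.totalDegree_mul _ _).trans ?_
          simp
      _ = d := by simpa using hI

lemma quadForm_nonneg_of_posSemidef {G : SimpleGraph (Fin n)} {d : ℕ} {ω : ℝ}
    (h : (mpwMatrix G d ω).PosSemidef) (l : ℝ) (s : Fin n) :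
    0 ≤ quadForm G d ω (testVec G d d l s) := by
  set v := testVec G d d l s with hv
  have hzero : ∀ I, #I ≠ d → v I = 0 := fun I hI => by simp [hv, testVec, hI]
  have h1 := h.dotProduct_mulVec_nonneg fun I => v I.1
  have hsub : ∀ f : Finset (Fin n) → ℝ, (∀ I, #I ≠ d → f I = 0) →
      ∑ I, f I = ∑ I : {I : Finset (Fin n) // #I = d}, f I.1 := by
    intro f hf
    rw [← sum_subtype (univ.filter fun I : Finset (Fin n) => #I = d) (by simp) f]
    exact (sum_filter_of_ne fun I _ hI => not_not.1 fun hc => hI (hf I hc)).symm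
  refine h1.trans_eq (Eq.symm ?_)
  rw [quadForm, hsub _ fun I hI => by simp [hzero I hI]]
  simp only [dotProduct, Matrix.mulVec, mpwMatrix, Matrix.of_apply, mul_sum, Pi.star_apply,
    star_trivial]
  refine sum_congr rfl fun I _ => ?_
  rw [hsub _ fun J hJ => by simp [hzero J hJ]]
  refine sum_congr rfl fun J _ => ?_
  rw [weight]
  ring

lemma withHighProbability_of_forall_vertex (A : ∀ n : ℕ, SimpleGraph (Fin n) → Prop)
    (B : ∀ n : ℕ, Fin n → SimpleGraph (Fin n) → Prop) (hBA : ∀ n s G, B n s G → A n G)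
    (hB : ∀ ε : ℝ, 0 < ε → ∀ᶠ n : ℕ in atTop, ∀ s : Fin n,
      1 - ε ≤ (randomGraph n).real {G | B n s G}) :
    WithHighProbability A := by
  have hprob : ∀ n, IsProbabilityMeasure (randomGraph n) := fun n => by
    unfold randomGraph; infer_instance
  rw [WithHighProbability, Metric.tendsto_nhds]
  intro ε hε
  filter_upwards [hB (ε / 2) (half_pos hε), eventually_gt_atTop 0] with n hn hn0
  have h1 : (randomGraph n).real {G | B n ⟨0, hn0⟩ G} ≤ (randomGraph n).real {G | A n G} :=
    measureReal_mono (fun G hG => hBA n _ G hG) (by finiteness)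
  have h2 : (randomGraph n).real {G | A n G} ≤ 1 := measureReal_le_one
  rw [Real.dist_eq, abs_lt]
  have h3 := hn ⟨0, hn0⟩
  constructor <;> linarith

end PlantedClique

theorem mainTheorem3 (d : ℕ) (hd : 1 ≤ d) :
    ∃ C : ℝ, 0 < C ∧ ∀ ω : ℕ → ℝ,
      Tendsto (fun n : ℕ => ω n / (n : ℝ) ^ ((1 : ℝ) / ((d : ℝ) + 1))) atTop atTop →
        PlantedClique.WithHighProbability
          (fun n G => ¬ PlantedClique.IsPSD (PlantedClique.mpw G d (ω n)) d) ∧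
        PlantedClique.WithHighProbability
          (fun n G => ¬ (PlantedClique.mpwMatrix G d (ω n)).PosSemidef) ∧
        ∀ ε : ℝ, 0 < ε → ∀ᶠ n : ℕ in atTop, ∀ s : Fin n,
          1 - ε ≤ (PlantedClique.randomGraph n).real
            {G | PlantedClique.mpw G d (ω n)
              (PlantedClique.kelnerPoly G d (ω n) C s ^ 2) < 0} := by
  open PlantedClique in
  refine ⟨testConst d, testConst_pos hd, fun ω hω => ?_⟩
  have hprob : ∀ n, IsProbabilityMeasure (randomGraph n) := fun n => by
    unfold randomGraph; infer_instance
  have hneg : ∀ ε : ℝ, 0 < ε → ∀ᶠ n : ℕ in atTop, ∀ s : Fin n,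
      1 - ε ≤ (randomGraph n).real
        {G | mpw G d (ω n) (kelnerPoly G d (ω n) (testConst d) s ^ 2) < 0} := by
    intro ε hε
    filter_upwards [quadForm_testVec_neg_whp hd le_rfl hd hω hε] with n hn s
    refine (hn s).trans (measureReal_mono ?_ (by finiteness))
    rintro G ⟨hpos, hlt⟩
    rw [Nat.add_sub_cancel] at hlt
    have hcount : (0 : ℝ) < cliqueCount G d := by
      exact_mod_cast hpos.trans_le (cliqueDeg_le_cliqueCount G d {s})
    simp only [Set.mem_ofPred_eq]
    rw [kelnerPoly_eq_multilinear, mpw_multilinear_sq]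
    exact div_neg_of_neg_of_pos hlt hcount
  refine ⟨?_, ?_, hneg⟩
  · refine withHighProbability_of_forall_vertex _ _ (fun n s G h => ?_) hneg
    exact fun hpsd => h.not_ge (hpsd _ (totalDegree_kelnerPoly_le G hd _ _ s))
  · refine withHighProbability_of_forall_vertex _ _ (fun n s G h => ?_)
      fun ε hε => quadForm_testVec_neg_whp hd hd le_rfl hω hε
    exact fun hpsd => h.2.not_ge (quadForm_nonneg_of_posSemidef hpsd _ s)
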